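/- Let $G$ be a nontrivial finite abelian group. Then there exist infinitely many number fields $K$ (as subfields of a fixed algebraic closure of $\mathbb{Q}$) such that $K/\mathbb{Q}$ is a Galois extension with $\mathrm{Gal}(K/\mathbb{Q}) \simeq G$, $K/\mathbb{Q}$ is tamely ramified (for every prime number $p$ and every prime $\mathfrak{P}$ of $K$ above $p$, the ramification index $e(\mathfrak{P}/p)$ is not divisible by $p$), $K$ is a Pólya field, and $K$ is the compositum of finitely many Pólya fields each of which is a cyclic extension of $\mathbb{Q}$ of degree a prime power greater than $1$. Here a number field $F$ is called a Pólya field if for every positive integer $l$ the product of all prime ideals of $\mathcal{O}_F$ of norm $l$ (equal to $\mathcal{O}_F$ if there are none) is a principal ideal. -/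

import Mathlib

open NumberField

/-- The product of all prime ideals of `𝓞 K` of norm `l`; it is the unit ideal
when `l` is not the norm of a prime ideal. -/
noncomputable def polyaIdeal (K : Type*) [Field K] [NumberField K] (l : ℕ) : Ideal (𝓞 K) :=
  ∏ᶠ 𝔭 ∈ {𝔭 : Ideal (𝓞 K) | 𝔭.IsPrime ∧ Ideal.absNorm 𝔭 = l}, 𝔭

/-- The product in `polyaIdeal` has finitely many factors (for `l = 0` the only factor is the
zero ideal). -/
theorem polyaIdeal_factors_finite (K : Type*) [Field K] [NumberField K] (l : ℕ) :
    {𝔭 : Ideal (𝓞 K) | 𝔭.IsPrime ∧ Ideal.absNorm 𝔭 = l}.Finite :=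
  (Ideal.finite_setOfPred_absNorm_eq l).subset fun _ h => h.2

/-- A number field `K` is a Pólya field if, for every positive integer `l`, the product of the
prime ideals of norm `l` is principal. -/
def IsPolyaField (K : Type*) [Field K] [NumberField K] : Prop :=
  ∀ l : ℕ, 0 < l → (polyaIdeal K l).IsPrincipal

/-- `K / ℚ` is tamely ramified: for every prime number `p` and every prime ideal `𝔓` of `𝓞 K`
over `p`, the ramification index of `𝔓` over `p` is prime to `p` (the residue fields are finite,
so the residue extensions are separable). -/
def IsTamelyRamified (K : Type*) [Field K] [NumberField K] : Prop :=
  ∀ p : ℕ, p.Prime → ∀ 𝔓 : Ideal (𝓞 K), 𝔓.IsPrime →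
    𝔓.LiesOver (Ideal.span {(p : ℤ)}) →
      ¬ p ∣ 𝔓.ramificationIdx ℤ

/-- `F / ℚ` is a cyclic Galois extension whose degree is a power `p ^ k` of a prime, `k ≥ 1`,
and `F` is a Pólya field. -/
def IsCyclicPrimePowPolyaField (F : Type*) [Field F] [NumberField F] : Prop :=
  IsGalois ℚ F ∧ IsCyclic Gal(F/ℚ) ∧ IsPrimePow (Module.finrank ℚ F) ∧ IsPolyaField F

/-! Write `G` as a product of cyclic groups of prime power orders `n i`, choose distinct primes `q i
≡ 1 mod n i`, and let `F i` be the subfield of `ℚ(ζ_{q i})` of degree `n i`; the field is `K = ⨆ i,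
F i`. Each `F i` is totally ramified at `q i`, while the other `F j` are unramified there. Hence
degrees multiply, the Galois group is the product, and `q i` has ramification index exactly `n i < q
i` in `K`, which is tame. The norm of `ζ - 1` to `F i` gives `α` with `(α) ^ n i = (q i)`
(`exists_span_pow_finrank_eq`), so `(α)` is the product of the primes over `q i`; this gives the
Pólya property (`isPolyaField_of_pow_eq`). Taking the `q i` large produces fields ramified at ever
larger primes, hence infinitely many. -/

/-! ### Ramification bounds and a criterion for the Pólya property -/

theorem ramificationIdx_eq_one_of_subfield_cyclotomic (K L : Type*) [Field K] [NumberField K]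
    [Field L] [NumberField L] [Algebra K L] {m : ℕ} [NeZero m] [IsCyclotomicExtension {m} ℚ L]
    {p : ℕ} (hp : p.Prime) (hpm : ¬ p ∣ m) (P : Ideal (𝓞 K)) [P.IsPrime]
    [P.LiesOver (Ideal.span {(p : ℤ)})] : P.ramificationIdx ℤ = 1 := by
  have : Fact p.Prime := ⟨hp⟩
  obtain ⟨Q, hQ, hQP⟩ : ∃ Q : Ideal (𝓞 L), Q.IsPrime ∧ Q.LiesOver P := by
    obtain ⟨Q⟩ := (inferInstance : Nonempty (Ideal.primesOver P (𝓞 L)))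
    exact ⟨Q.1, Q.2.1, Q.2.2⟩
  have : Q.LiesOver (Ideal.span {(p : ℤ)}) := .trans Q P _
  have h := IsCyclotomicExtension.Rat.ramificationIdx_eq_of_not_dvd p L Q hpm
  exact Nat.dvd_one.mp (h ▸ Ideal.ramificationIdx_below_dvd (R := ℤ) P Q)

theorem ramificationIdx_le_finrank_numberField (K L : Type*) [Field K] [NumberField K]
    [Field L] [NumberField L] [Algebra K L] (Q : Ideal (𝓞 L)) [Q.IsPrime] :
    Q.ramificationIdx (𝓞 K) ≤ Module.finrank K L := by
  have : Fintype ((Q.under (𝓞 K)).primesOver (𝓞 L)) := (Algebra.QuasiFinite.finite_primesOver _).fintype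
  have h := Ideal.sum_ramification_inertia_eq_finrank (S := 𝓞 L) (Q.under (𝓞 K))
  rw [IsFractionRing.finrank_eq (𝓞 K) K (𝓞 L) L, ← h]
  let Q' : (Q.under (𝓞 K)).primesOver (𝓞 L) := ⟨Q, inferInstance, inferInstance⟩
  calc Q.ramificationIdx (𝓞 K) ≤ Q'.1.ramificationIdx (𝓞 K) * Q'.1.inertiaDeg (𝓞 K) :=
        Nat.le_mul_of_pos_right _ (Ideal.inertiaDeg_pos _ _)
    _ ≤ _ := Finset.single_le_sum
        (f := fun q : (Q.under (𝓞 K)).primesOver (𝓞 L) ↦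
          q.1.ramificationIdx (𝓞 K) * q.1.inertiaDeg (𝓞 K))
        (fun _ _ ↦ Nat.zero_le _) (Finset.mem_univ Q')

/-- All ramification occurs in the top step `L / K`, where it is at most `[L : K]`. This serves both
the degree of the compositum and the upper bound on its ramification. -/
theorem ramificationIdx_mul_finrank_le_of_under (K L : Type*) [Field K] [NumberField K]
    [Field L] [NumberField L] [Algebra K L] (Q : Ideal (𝓞 L)) [Q.IsPrime]
    (h : (Q.under (𝓞 K)).ramificationIdx ℤ = 1) :
    Q.ramificationIdx ℤ * Module.finrank ℚ K ≤ Module.finrank ℚ L := by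
  rw [Ideal.ramificationIdx_tower (R := ℤ) (Q.under (𝓞 K)) Q, h, one_mul,
    ← Module.finrank_mul_finrank ℚ K L, mul_comm]
  exact Nat.mul_le_mul_left _ (ramificationIdx_le_finrank_numberField K L Q)

theorem exists_prime_liesOver {K : Type*} [Field K] [NumberField K] (P : Ideal (𝓞 K))
    [P.IsPrime] (hP : P ≠ ⊥) : ∃ p : ℕ, p.Prime ∧ P.LiesOver (Ideal.span {(p : ℤ)}) :=
  have : NeZero P := ⟨hP⟩
  ⟨_, Nat.absNorm_under_prime P, inferInstance⟩

/-- In a Galois field the primes over `p` share one norm, so the primes of a given norm are all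
those over one `p`. The `e`-th power of their product is `(p) = (α) ^ e`, and `e`-th roots of ideals
are unique. -/
theorem isPolyaField_of_pow_eq (K : Type*) [Field K] [NumberField K] [IsGalois ℚ K]
    (h : ∀ p : ℕ, p.Prime → ∃ (e : ℕ) (α : 𝓞 K),
      (Ideal.span {α}) ^ e = Ideal.span {(p : 𝓞 K)} ∧
      ∀ P : Ideal (𝓞 K), P.IsPrime → P.LiesOver (Ideal.span {(p : ℤ)}) →
        P.ramificationIdx ℤ = e) : IsPolyaField K := by
  intro l hl
  by_cases hex : ∃ P : Ideal (𝓞 K), P.IsPrime ∧ Ideal.absNorm P = l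
  swap
  · have : polyaIdeal K l = ⊤ := by
      rw [polyaIdeal, ← Ideal.one_eq_top]
      exact finprod_mem_eq_one_of_forall_eq_one fun P hP ↦ (hex ⟨P, hP⟩).elim
    rw [this]
    exact inferInstance
  obtain ⟨P₀, hP₀, rfl⟩ := hex
  have hbot : P₀ ≠ ⊥ := by rintro rfl; simp at hl
  have hmax := hP₀.isMaximal hbot
  obtain ⟨p, hp, hover⟩ := exists_prime_liesOver P₀ hbot
  obtain ⟨e, α, hα, he⟩ := h p hp
  have hset : {P : Ideal (𝓞 K) | P.IsPrime ∧ Ideal.absNorm P = Ideal.absNorm P₀} =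
      (Ideal.span {(p : ℤ)}).primesOver (𝓞 K) := by
    ext P
    constructor
    · rintro ⟨hP, hN⟩
      refine ⟨hP, ?_⟩
      have hP0 : P ≠ ⊥ := by
        rintro rfl
        rw [Ideal.absNorm_bot] at hN
        exact hl.ne hN
      obtain ⟨r, hr, hro⟩ := exists_prime_liesOver P hP0
      have hdvd : r ∣ p ^ P₀.inertiaDeg ℤ := by
        rw [Ideal.pow_inertiaDeg p P₀, ← hN, ← Ideal.pow_inertiaDeg r P]
        exact dvd_pow_self _ (Ideal.inertiaDeg_pos P ℤ).ne'
      rwa [← (Nat.prime_dvd_prime_iff_eq hr hp).mp (hr.dvd_of_dvd_pow hdvd)]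
    · rintro ⟨hP, hPo⟩
      refine ⟨hP, ?_⟩
      rw [← Ideal.pow_inertiaDeg p P, ← Ideal.pow_inertiaDeg p P₀,
        Ideal.inertiaDeg_eq_of_isGaloisGroup (Ideal.span {(p : ℤ)}) P P₀ Gal(K/ℚ)]
  have hp0 : Ideal.span {(p : ℤ)} ≠ 0 := by simpa using hp.ne_zero
  have : Fact p.Prime := ⟨hp⟩
  have he0 : e ≠ 0 := by
    rw [← he P₀ hP₀ hover]; exact (Ideal.ramificationIdx_pos P₀ ℤ).ne'
  have hprod := Ideal.map_algebraMap_eq_finsetProd_pow (R := 𝓞 K) hp0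
  rw [Ideal.map_span, Set.image_singleton, map_natCast, ← hα] at hprod
  have hpow : (Ideal.span {α}) ^ e = (polyaIdeal K (Ideal.absNorm P₀)) ^ e := by
    rw [hprod, polyaIdeal, hset]
    rw [finprod_mem_eq_toFinset_prod, ← Finset.prod_pow]
    refine Finset.prod_congr rfl fun P hP ↦ ?_
    rw [Set.mem_toFinset] at hP
    rw [he P hP.1 hP.2]
  exact ⟨α, (pow_left_injective he0 hpow).symm⟩

/-- Take relative norms in `(q) = (ζ - 1) ^ [L : ℚ]`: the left side becomes `(q) ^ [L : F]`, and
extracting the `[L : F]`-th root leaves exponent `[F : ℚ]`. -/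
theorem exists_span_pow_finrank_eq (F L : Type*) [Field F] [NumberField F]
    [Field L] [NumberField L] [Algebra F L] {q : ℕ} (hq : q.Prime) [IsCyclotomicExtension {q} ℚ L] :
    ∃ α : 𝓞 F, (Ideal.span {α}) ^ Module.finrank ℚ F = Ideal.span {(q : 𝓞 F)} := by
  have : Fact q.Prime := ⟨hq⟩
  have : IsCyclotomicExtension {q ^ (0 + 1)} ℚ L := by simpa
  have hζ := IsCyclotomicExtension.zeta_spec (q ^ (0 + 1)) ℚ L
  have h := IsCyclotomicExtension.Rat.map_eq_span_zeta_sub_one_pow q 0 hζ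
  refine ⟨Algebra.intNorm (𝓞 F) (𝓞 L) (hζ.toInteger - 1), ?_⟩
  have h2 := congrArg (Ideal.relNorm (𝓞 F)) h
  rw [map_pow, Ideal.relNorm_singleton, Ideal.relNorm_algebraMap'] at h2
  rw [← Module.finrank_mul_finrank ℚ F L, pow_mul] at h2
  rw [Ideal.map_span, Set.image_singleton, map_natCast,
    IsFractionRing.finrank_eq (𝓞 F) F (𝓞 L) L] at h2
  exact (pow_left_injective Module.finrank_pos.ne' h2).symm

theorem le_ramificationIdx_of_pow_eq (K : Type*) [Field K] [NumberField K]
    {p : ℕ} (hp : p.Prime) {e : ℕ} {α : 𝓞 K} (h : (Ideal.span {α}) ^ e = Ideal.span {(p : 𝓞 K)})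
    (P : Ideal (𝓞 K)) [P.IsPrime] [P.LiesOver (Ideal.span {(p : ℤ)})] :
    e ≤ P.ramificationIdx ℤ := by
  have h0 : (Ideal.span {(p : ℤ)}).map (algebraMap ℤ (𝓞 K)) ≠ ⊥ := by
    simpa [Ideal.map_span] using hp.ne_zero
  have hP0 : P ≠ ⊥ := ne_bot_of_le_ne_bot h0 (Ideal.map_le_of_le_comap
    (Ideal.over_def P (Ideal.span {(p : ℤ)})).le)
  rw [Ideal.IsDedekindDomain.ramificationIdx_eq_multiplicity (Ideal.span {(p : ℤ)}) P h0]
  have hle : Ideal.span {α} ≤ P := by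
    refine Ideal.IsPrime.le_of_pow_le (n := e) ?_
    rw [h, Ideal.span_singleton_le_iff_mem]
    have := (Ideal.mem_of_liesOver P (Ideal.span {(p : ℤ)}) p).mp (Ideal.mem_span_singleton_self _)
    simpa using this
  refine FiniteMultiplicity.le_multiplicity_of_pow_dvd ?_ ?_
  · exact FiniteMultiplicity.of_prime_left (Ideal.prime_of_isPrime hP0 inferInstance) h0
  · rw [Ideal.map_span, Set.image_singleton, map_natCast, ← h]
    exact pow_dvd_pow_of_dvd (Ideal.dvd_iff_le.mpr hle) e

/-- The subfield of an extension of `ℚ` generated by the `n`-th roots of unity. -/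
def cyclotomicSubfield (Ω : Type*) [Field Ω] [CharZero Ω] (n : ℕ) : IntermediateField ℚ Ω :=
  IntermediateField.adjoin ℚ {x : Ω | x ^ n = 1}

/-! ### Subfields of cyclotomic fields inside a fixed algebraically closed field -/

section

variable {Ω : Type*} [Field Ω] [CharZero Ω]

theorem cyclotomicSubfield_mono {m n : ℕ} (h : m ∣ n) :
    cyclotomicSubfield Ω m ≤ cyclotomicSubfield Ω n := by
  refine IntermediateField.adjoin.mono _ _ _ fun x (hx : x ^ m = 1) ↦ ?_
  obtain ⟨k, rfl⟩ := h
  change x ^ (m * k) = 1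
  rw [pow_mul, hx, one_pow]

instance isCyclotomicExtension_cyclotomicSubfield [IsAlgClosed Ω] (n : ℕ) [NeZero n] :
    IsCyclotomicExtension {n} ℚ (cyclotomicSubfield Ω n) := by
  have : NeZero (n : Ω) := ⟨Nat.cast_ne_zero.mpr (NeZero.ne n)⟩
  have h := IntermediateField.isCyclotomicExtension_adjoin_of_exists_isPrimitiveRoot {n} ℚ Ω
    (fun m hm _ ↦ by
      obtain rfl : m = n := hm
      exact HasEnoughRootsOfUnity.exists_primitiveRoot Ω m)
  have hs : {x : Ω | x ^ n = 1} = {b | ∃ m ∈ ({n} : Set ℕ), m ≠ 0 ∧ b ^ m = 1} := by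
    simp [NeZero.ne n]
  rw [cyclotomicSubfield, hs]
  exact h

instance [IsAlgClosed Ω] (n : ℕ) [NeZero n] : NumberField (cyclotomicSubfield Ω n) :=
  IsCyclotomicExtension.numberField {n} ℚ _

instance [IsAlgClosed Ω] (n : ℕ) [NeZero n] : IsAbelianGalois ℚ (cyclotomicSubfield Ω n) :=
  IsCyclotomicExtension.isAbelianGalois {n} ℚ _

theorem numberField_of_le {A B : IntermediateField ℚ Ω} (h : A ≤ B) [NumberField B] :
    NumberField A := by
  have := Module.Finite.of_injective (IntermediateField.inclusion h).toLinearMap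
    (IntermediateField.inclusion h).injective
  exact { }

theorem isAbelianGalois_of_le {A B : IntermediateField ℚ Ω} (h : A ≤ B) [IsAbelianGalois ℚ B] :
    IsAbelianGalois ℚ A :=
  let := (IntermediateField.inclusion h).toRingHom.toAlgebra
  .tower_bot ℚ A B

theorem ramificationIdx_eq_one_of_le_cyclotomicSubfield [IsAlgClosed Ω]
    {A : IntermediateField ℚ Ω} [NumberField A] {m : ℕ} [NeZero m]
    (h : A ≤ cyclotomicSubfield Ω m) {p : ℕ} (hp : p.Prime) (hpm : ¬ p ∣ m)
    (P : Ideal (𝓞 A)) [P.IsPrime] [P.LiesOver (Ideal.span {(p : ℤ)})] :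
    P.ramificationIdx ℤ = 1 := by
  let := (IntermediateField.inclusion h).toRingHom.toAlgebra
  exact ramificationIdx_eq_one_of_subfield_cyclotomic A (cyclotomicSubfield Ω m) hp hpm P

theorem ramificationIdx_mul_finrank_le [IsAlgClosed Ω]
    {B K : IntermediateField ℚ Ω} [NumberField B] [NumberField K] (hBK : B ≤ K)
    {m : ℕ} [NeZero m] (h : B ≤ cyclotomicSubfield Ω m) {p : ℕ} (hp : p.Prime) (hpm : ¬ p ∣ m)
    (P : Ideal (𝓞 K)) [P.IsPrime] [P.LiesOver (Ideal.span {(p : ℤ)})] :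
    P.ramificationIdx ℤ * Module.finrank ℚ B ≤ Module.finrank ℚ K := by
  let := (IntermediateField.inclusion hBK).toRingHom.toAlgebra
  exact ramificationIdx_mul_finrank_le_of_under B K P
    (ramificationIdx_eq_one_of_le_cyclotomicSubfield h hp hpm (P.under (𝓞 B)))

theorem exists_span_pow_finrank_eq_of_le [IsAlgClosed Ω]
    {F K : IntermediateField ℚ Ω} [NumberField K] (hFK : F ≤ K)
    {q : ℕ} (hq : q.Prime) (h : F ≤ cyclotomicSubfield Ω q) :
    ∃ α : 𝓞 K, (Ideal.span {α}) ^ Module.finrank ℚ F = Ideal.span {(q : 𝓞 K)} := by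
  have : NeZero q := ⟨hq.ne_zero⟩
  have := numberField_of_le hFK
  let := (IntermediateField.inclusion hFK).toRingHom.toAlgebra
  let := (IntermediateField.inclusion h).toRingHom.toAlgebra
  obtain ⟨α, hα⟩ := exists_span_pow_finrank_eq F (cyclotomicSubfield Ω q) hq
  refine ⟨algebraMap (𝓞 F) (𝓞 K) α, ?_⟩
  simpa [Ideal.map_pow, Ideal.map_span] using congrArg (Ideal.map (algebraMap (𝓞 F) (𝓞 K))) hα

end

/-- `F i` is a subfield of `ℚ(ζ_{q i})` for distinct primes `q i`. -/
structure IsPrimeConductorFamily {ι Ω : Type*} [Field Ω] [CharZero Ω]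
    (F : ι → IntermediateField ℚ Ω) (q : ι → ℕ) : Prop where
  prime : ∀ i, (q i).Prime
  injective : Function.Injective q
  le : ∀ i, F i ≤ cyclotomicSubfield Ω (q i)

/-! ### Composita of fields of distinct prime conductors -/

namespace IsPrimeConductorFamily

variable {ι Ω : Type*} [Field Ω] [CharZero Ω] {F : ι → IntermediateField ℚ Ω} {q : ι → ℕ}

theorem biSup_le (h : IsPrimeConductorFamily F q) (s : Finset ι) :
    ⨆ i ∈ s, F i ≤ cyclotomicSubfield Ω (∏ i ∈ s, q i) :=
  iSup₂_le fun i hi ↦ (h.le i).trans (cyclotomicSubfield_mono (Finset.dvd_prod_of_mem q hi))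

theorem prod_ne_zero (h : IsPrimeConductorFamily F q) (s : Finset ι) : NeZero (∏ i ∈ s, q i) :=
  ⟨Finset.prod_ne_zero_iff.mpr fun i _ ↦ (h.prime i).ne_zero⟩

theorem not_dvd_prod (h : IsPrimeConductorFamily F q) {s : Finset ι} {i : ι} (hi : i ∉ s) :
    ¬ q i ∣ ∏ j ∈ s, q j := by
  rw [(h.prime i).prime.dvd_finsetProd_iff]
  rintro ⟨j, hj, hij⟩
  exact hi (h.injective ((Nat.prime_dvd_prime_iff_eq (h.prime i) (h.prime j)).mp hij) ▸ hj)

theorem iSup_le [Fintype ι] (h : IsPrimeConductorFamily F q) :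
    ⨆ i, F i ≤ cyclotomicSubfield Ω (∏ i, q i) := by
  simpa using h.biSup_le Finset.univ

variable [IsAlgClosed Ω]

theorem numberField_biSup (h : IsPrimeConductorFamily F q) (s : Finset ι) :
    NumberField ↥(⨆ i ∈ s, F i) :=
  have := h.prod_ne_zero s
  numberField_of_le (h.biSup_le s)

theorem numberField (h : IsPrimeConductorFamily F q) (i : ι) : NumberField (F i) :=
  have : NeZero (q i) := ⟨(h.prime i).ne_zero⟩
  numberField_of_le (h.le i)

theorem isAbelianGalois (h : IsPrimeConductorFamily F q) (i : ι) : IsAbelianGalois ℚ (F i) :=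
  have : NeZero (q i) := ⟨(h.prime i).ne_zero⟩
  isAbelianGalois_of_le (h.le i)

theorem le_ramificationIdx (h : IsPrimeConductorFamily F q) (i : ι) {K : IntermediateField ℚ Ω}
    [NumberField K] (hK : F i ≤ K) (P : Ideal (𝓞 K)) [P.IsPrime]
    [P.LiesOver (Ideal.span {(q i : ℤ)})] :
    Module.finrank ℚ (F i) ≤ P.ramificationIdx ℤ := by
  obtain ⟨α, hα⟩ := exists_span_pow_finrank_eq_of_le hK (h.prime i) (h.le i)
  exact le_ramificationIdx_of_pow_eq K (h.prime i) hα P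

/-- Linear disjointness is read off from ramification: when `F a` is adjoined, a prime over `q a`
has index at least `[F a : ℚ]`, and the old compositum, unramified there, contributes none of it. -/
theorem finrank_biSup (h : IsPrimeConductorFamily F q) (s : Finset ι) :
    Module.finrank ℚ ↥(⨆ i ∈ s, F i) = ∏ i ∈ s, Module.finrank ℚ (F i) := by
  classical
  induction s using Finset.induction_on with
  | empty => simp
  | insert a s ha ih =>
    rw [Finset.prod_insert ha]
    have := h.numberField_biSup s
    have := h.numberField_biSup (insert a s)
    have := h.prod_ne_zero s
    apply le_antisymm
    · rw [Finset.iSup_insert, ← ih]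
      exact IntermediateField.finrank_sup_le _ _
    · have : ((Ideal.span {(q a : ℤ)})).IsPrime := by
        rw [Ideal.span_singleton_prime (by exact_mod_cast (h.prime a).ne_zero)]
        exact Nat.prime_iff_prime_int.mp (h.prime a)
      obtain ⟨P, hP, hPo⟩ := (inferInstance : Nonempty
        (Ideal.primesOver (Ideal.span {(q a : ℤ)}) (𝓞 ↥(⨆ i ∈ insert a s, F i))))
      have h1 := h.le_ramificationIdx a
        (le_iSup₂_of_le a (Finset.mem_insert_self a s) le_rfl) P
      have h2 := ramificationIdx_mul_finrank_le
        (biSup_mono fun i hi ↦ Finset.mem_insert_of_mem hi) (h.biSup_le s) (h.prime a)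
        (h.not_dvd_prod ha) P
      rw [← ih]
      exact (Nat.mul_le_mul_right _ h1).trans h2

variable [Fintype ι]

theorem numberField_iSup (h : IsPrimeConductorFamily F q) : NumberField ↥(⨆ i, F i) :=
  have := h.prod_ne_zero Finset.univ
  numberField_of_le h.iSup_le

theorem isAbelianGalois_iSup (h : IsPrimeConductorFamily F q) : IsAbelianGalois ℚ ↥(⨆ i, F i) :=
  have := h.prod_ne_zero Finset.univ
  isAbelianGalois_of_le h.iSup_le

theorem finrank_iSup (h : IsPrimeConductorFamily F q) :
    Module.finrank ℚ ↥(⨆ i, F i) = ∏ i, Module.finrank ℚ (F i) := by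
  have := h.finrank_biSup Finset.univ
  rwa [show ⨆ i ∈ Finset.univ, F i = ⨆ i, F i by simp] at this

theorem ramificationIdx_eq_finrank (h : IsPrimeConductorFamily F q) [NumberField ↥(⨆ i, F i)]
    (i : ι) (P : Ideal (𝓞 ↥(⨆ i, F i))) [P.IsPrime] [P.LiesOver (Ideal.span {(q i : ℤ)})] :
    P.ramificationIdx ℤ = Module.finrank ℚ (F i) := by
  classical
  refine le_antisymm ?_ (h.le_ramificationIdx i (le_iSup F i) P)
  have := h.numberField_biSup (Finset.univ.erase i)
  have := h.prod_ne_zero (Finset.univ.erase i)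
  have h2 := ramificationIdx_mul_finrank_le
    (_root_.iSup_le fun j ↦ _root_.iSup_le fun _ ↦ le_iSup F j)
    (h.biSup_le (Finset.univ.erase i)) (h.prime i)
    (h.not_dvd_prod (Finset.notMem_erase i _)) P
  rw [h.finrank_iSup, h.finrank_biSup, ← Finset.mul_prod_erase _ _ (Finset.mem_univ i)] at h2
  refine Nat.le_of_mul_le_mul_right h2 (Finset.prod_pos fun j _ ↦ ?_)
  have := h.numberField j
  exact Module.finrank_pos

theorem ramificationIdx_eq_one (h : IsPrimeConductorFamily F q) [NumberField ↥(⨆ i, F i)]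
    {p : ℕ} (hp : p.Prime) (hpq : ∀ i, p ≠ q i) (P : Ideal (𝓞 ↥(⨆ i, F i))) [P.IsPrime]
    [P.LiesOver (Ideal.span {(p : ℤ)})] : P.ramificationIdx ℤ = 1 := by
  have := h.prod_ne_zero Finset.univ
  refine ramificationIdx_eq_one_of_le_cyclotomicSubfield h.iSup_le hp ?_ P
  rw [hp.prime.dvd_finsetProd_iff]
  rintro ⟨j, -, hj⟩
  exact hpq j ((Nat.prime_dvd_prime_iff_eq hp (h.prime j)).mp hj)

theorem isTamelyRamified (h : IsPrimeConductorFamily F q) [NumberField ↥(⨆ i, F i)]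
    (hlt : ∀ i, Module.finrank ℚ (F i) < q i) : IsTamelyRamified ↥(⨆ i, F i) := by
  intro p hp P _ _ hdvd
  by_cases hpq : ∃ i, p = q i
  · obtain ⟨i, rfl⟩ := hpq
    rw [h.ramificationIdx_eq_finrank i P] at hdvd
    have := h.numberField i
    exact (hlt i).not_ge (Nat.le_of_dvd Module.finrank_pos hdvd)
  · rw [h.ramificationIdx_eq_one hp (not_exists.mp hpq) P] at hdvd
    exact hp.not_dvd_one hdvd

theorem isPolyaField (h : IsPrimeConductorFamily F q) [NumberField ↥(⨆ i, F i)] :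
    IsPolyaField ↥(⨆ i, F i) := by
  have := h.isAbelianGalois_iSup
  refine isPolyaField_of_pow_eq _ fun p hp ↦ ?_
  by_cases hpq : ∃ i, p = q i
  · obtain ⟨i, rfl⟩ := hpq
    obtain ⟨α, hα⟩ := exists_span_pow_finrank_eq_of_le (le_iSup F i) hp (h.le i)
    exact ⟨_, α, hα, fun P _ _ ↦ h.ramificationIdx_eq_finrank i P⟩
  · exact ⟨1, p, pow_one _, fun P _ _ ↦ h.ramificationIdx_eq_one hp (not_exists.mp hpq) P⟩

theorem nonempty_gal_mulEquiv (h : IsPrimeConductorFamily F q) :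
    Nonempty (Gal(↥(⨆ i, F i)/ℚ) ≃* ∀ i, Gal(F i/ℚ)) := by
  have := h.isAbelianGalois_iSup
  have := h.numberField_iSup
  have := h.isAbelianGalois
  have := h.numberField
  let (i : ι) : Algebra (F i) ↥(⨆ i, F i) :=
    (IntermediateField.inclusion (le_iSup F i)).toRingHom.toAlgebra
  let φ : Gal(↥(⨆ i, F i)/ℚ) →* ∀ i, Gal(F i/ℚ) :=
    MonoidHom.pi fun i ↦ AlgEquiv.restrictNormalHom (F i)
  refine ⟨MulEquiv.ofBijective φ ((Nat.bijective_iff_injective_and_card φ).mpr ⟨?_, ?_⟩)⟩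
  · rw [injective_iff_map_eq_one]
    intro σ hσ
    -- An automorphism trivial on every `F i` has a fixed field containing their compositum.
    have hle : ⨆ i, F i ≤ IntermediateField.lift
        (IntermediateField.fixedField (Subgroup.zpowers σ)) := by
      refine _root_.iSup_le fun i x hx ↦ ?_
      have h1 : σ ⟨x, le_iSup F i hx⟩ = ⟨x, le_iSup F i hx⟩ := by
        have := AlgEquiv.restrictNormal_commutes σ (F i) ⟨x, hx⟩
        have h2 : σ.restrictNormal (F i) = 1 := congrFun hσ i
        rw [h2] at this
        exact this.symm
      refine (IntermediateField.mem_lift (⟨x, le_iSup F i hx⟩ : ↥(⨆ i, F i))).mpr ?_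
      rw [IntermediateField.mem_fixedField_iff]
      intro τ hτ
      have hle : Subgroup.zpowers σ ≤ MulAction.stabilizer _ (⟨x, le_iSup F i hx⟩ : ↥(⨆ i, F i)) :=
        Subgroup.zpowers_le.mpr h1
      exact hle hτ
    ext x
    have := (IntermediateField.mem_lift x).mp (hle x.2)
    rw [IntermediateField.mem_fixedField_iff] at this
    exact congrArg Subtype.val (this σ (Subgroup.mem_zpowers σ))
  · rw [IsGalois.card_aut_eq_finrank, h.finrank_iSup, Nat.card_pi]
    exact Finset.prod_congr rfl fun i _ ↦ (IsGalois.card_aut_eq_finrank ℚ (F i)).symm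

end IsPrimeConductorFamily

/-! ### Cyclic fields of prime conductor and prescribed degree -/

theorem exists_intermediateField_finrank_eq (L : Type*) [Field L] [NumberField L] [IsGalois ℚ L]
    [IsCyclic Gal(L/ℚ)] {k : ℕ} (hk : k ∣ Module.finrank ℚ L) :
    ∃ E : IntermediateField ℚ L, Module.finrank ℚ E = k := by
  obtain ⟨g, hg⟩ := IsCyclic.exists_ofOrder_eq_natCard (α := Gal(L/ℚ))
  rw [IsGalois.card_aut_eq_finrank] at hg
  have hpos : 0 < Module.finrank ℚ L := Module.finrank_pos
  obtain ⟨m, hm⟩ := hk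
  have hk0 : k ≠ 0 := by rintro rfl; simp [hm] at hpos
  have hm0 : 0 < m := Nat.pos_of_ne_zero (by rintro rfl; simp [hm] at hpos)
  refine ⟨IntermediateField.fixedField (Subgroup.zpowers (g ^ k)), ?_⟩
  have h1 := IntermediateField.finrank_fixedField_eq_card (Subgroup.zpowers (g ^ k))
  rw [Nat.card_zpowers, orderOf_pow_of_dvd hk0 (hg ▸ ⟨m, hm⟩), hg, hm,
    Nat.mul_div_cancel_left _ (Nat.pos_of_ne_zero hk0)] at h1
  have h2 := Module.finrank_mul_finrank ℚ
    (IntermediateField.fixedField (Subgroup.zpowers (g ^ k))) L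
  rw [h1, hm] at h2
  exact Nat.eq_of_mul_eq_mul_right hm0 h2

section SubfieldsOfPrimeConductor

variable {Ω : Type*} [Field Ω] [CharZero Ω] [IsAlgClosed Ω]

theorem isCyclic_gal_cyclotomicSubfield {q : ℕ} (hq : q.Prime) :
    have : NeZero q := ⟨hq.ne_zero⟩
    IsCyclic Gal(cyclotomicSubfield Ω q/ℚ) :=
  have : Fact q.Prime := ⟨hq⟩
  isCyclic_of_injective _
    (IsCyclotomicExtension.Rat.galEquivZMod q (cyclotomicSubfield Ω q)).injective

theorem exists_le_cyclotomicSubfield_finrank_eq (Ω : Type*) [Field Ω] [CharZero Ω] [IsAlgClosed Ω]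
    {q k : ℕ} (hq : q.Prime) (hk : k ∣ q - 1) :
    ∃ F : IntermediateField ℚ Ω, F ≤ cyclotomicSubfield Ω q ∧ Module.finrank ℚ F = k := by
  have : NeZero q := ⟨hq.ne_zero⟩
  have := isCyclic_gal_cyclotomicSubfield (Ω := Ω) hq
  rw [← Nat.totient_prime hq,
    ← IsCyclotomicExtension.Rat.finrank q (cyclotomicSubfield Ω q)] at hk
  obtain ⟨E, hE⟩ := exists_intermediateField_finrank_eq (cyclotomicSubfield Ω q) hk
  refine ⟨IntermediateField.lift E, IntermediateField.lift_le E, ?_⟩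
  rw [← hE]
  exact (IntermediateField.liftAlgEquiv E).toLinearEquiv.finrank_eq.symm

theorem isCyclic_gal_of_le {q : ℕ} (hq : q.Prime) {F : IntermediateField ℚ Ω}
    (h : F ≤ cyclotomicSubfield Ω q) : IsCyclic Gal(F/ℚ) := by
  have : NeZero q := ⟨hq.ne_zero⟩
  have := isCyclic_gal_cyclotomicSubfield (Ω := Ω) hq
  have := isAbelianGalois_of_le h
  let := (IntermediateField.inclusion h).toRingHom.toAlgebra
  exact isCyclic_of_surjective (AlgEquiv.restrictNormalHom F (K₁ := cyclotomicSubfield Ω q))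
    (AlgEquiv.restrictNormalHom_surjective _)

theorem isCyclicPrimePowPolyaField_of_le {q : ℕ} (hq : q.Prime) {F : IntermediateField ℚ Ω}
    [NumberField F] (h : F ≤ cyclotomicSubfield Ω q) (hF : IsPrimePow (Module.finrank ℚ F)) :
    IsCyclicPrimePowPolyaField F := by
  have : NeZero q := ⟨hq.ne_zero⟩
  have := isAbelianGalois_of_le h
  refine ⟨inferInstance, isCyclic_gal_of_le hq h, hF, ?_⟩
  have hfam : IsPrimeConductorFamily (fun _ : Unit ↦ F) (fun _ ↦ q) :=
    ⟨fun _ ↦ hq, Function.injective_of_subsingleton _, fun _ ↦ h⟩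
  -- Generalizing over `K` and its instance lets the equality of the one-member compositum with `F`
  -- be substituted.
  have key : ∀ K : IntermediateField ℚ Ω, (⨆ _ : Unit, F) = K → ∀ _ : NumberField K,
      IsPolyaField K := by
    rintro _ rfl _
    exact hfam.isPolyaField
  exact key F ciSup_const _

end SubfieldsOfPrimeConductor

/-! ### Choice of the cyclic factors and the primes -/

theorem CommGroup.exists_mulEquiv_pi_zmod_isPrimePow (G : Type*) [CommGroup G] [Finite G] :
    ∃ (ι : Type) (_ : Fintype ι) (n : ι → ℕ), (∀ i, IsPrimePow (n i)) ∧
      Nonempty (G ≃* ∀ i, Multiplicative (ZMod (n i))) := by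
  classical
  obtain ⟨ι, _, p, hp, e, ⟨f⟩⟩ := AddCommGroup.equiv_directSum_zmod_of_finite (Additive G)
  let g : G ≃* ∀ i, Multiplicative (ZMod (p i ^ e i)) :=
    MulEquiv.toAdditive.symm <| f.trans <|
      (DirectSum.addEquivProd _).trans (MulEquiv.piMultiplicative _).toAdditiveRight
  -- Factors with `e i = 0` are trivial and are dropped.
  let φ : (∀ i, Multiplicative (ZMod (p i ^ e i))) →*
      ∀ i : {i // e i ≠ 0}, Multiplicative (ZMod (p i ^ e i)) :=
    MonoidHom.pi fun i ↦ Pi.evalMonoidHom _ i.1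
  refine ⟨{i // e i ≠ 0}, inferInstance, fun i ↦ p i ^ e i,
    fun i ↦ (hp i).isPrimePow.pow i.2, ⟨g.trans (MulEquiv.ofBijective φ ⟨fun x y hxy ↦ ?_,
      fun y ↦ ⟨fun i ↦ if h : e i ≠ 0 then y ⟨i, h⟩ else 1, ?_⟩⟩)⟩⟩
  · funext i
    by_cases h : e i = 0
    · have : Subsingleton (ZMod (p i ^ e i)) := by
        rw [h, pow_zero]
        infer_instance
      exact Subsingleton.elim (α := ZMod (p i ^ e i)) _ _
    · exact congrFun hxy ⟨i, h⟩
  · funext i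
    exact dif_pos i.2

theorem exists_injective_prime_modEq_one {ι : Type*} [Finite ι] {n : ι → ℕ} (hn : ∀ i, n i ≠ 0)
    (B : ℕ) : ∃ q : ι → ℕ, Function.Injective q ∧
      ∀ i, (q i).Prime ∧ n i ∣ q i - 1 ∧ B < q i := by
  have := Fintype.ofFinite ι
  have hinf := (Nat.infinite_setOfPred_prime_modEq_one
    (Finset.prod_ne_zero_iff.mpr fun i _ ↦ hn i : ∏ i, n i ≠ 0)).sdiff (Set.finite_Iic B)
  let q (i : ι) := hinf.natEmbedding _ (Fintype.equivFin ι i)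
  refine ⟨fun i ↦ q i, fun i j hij ↦ ?_, fun i ↦ ⟨(q i).2.1.1, ?_, not_le.mp (q i).2.2⟩⟩
  · have := (hinf.natEmbedding _).injective (Subtype.ext hij)
    exact (Fintype.equivFin ι).injective (Fin.ext this)
  · refine (Finset.dvd_prod_of_mem n (Finset.mem_univ i)).trans ?_
    exact (Nat.modEq_iff_dvd' (q i).2.1.1.one_le).mp (q i).2.1.2.symm

/-! ### Construction of infinitely many fields -/

theorem mainTheorem6 (G : Type*) [CommGroup G] [Finite G] [Nontrivial G] :
    {K : IntermediateField ℚ (AlgebraicClosure ℚ) |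
      ∃ _ : NumberField K,
        IsAbelianGalois ℚ K ∧ Nonempty (Gal(K/ℚ) ≃* G) ∧
        IsTamelyRamified K ∧ IsPolyaField K ∧
        ∃ (n : ℕ) (F : Fin n → IntermediateField ℚ (AlgebraicClosure ℚ)),
          K = ⨆ i, F i ∧
          ∀ i, ∃ _ : NumberField (F i), IsCyclicPrimePowPolyaField (F i)}.Infinite := by
  obtain ⟨ι, _, n, hn, ⟨f⟩⟩ := CommGroup.exists_mulEquiv_pi_zmod_isPrimePow G
  have hι : Nonempty ι := by
    by_contra hι
    rw [not_nonempty_iff] at hι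
    exact not_subsingleton G f.toEquiv.subsingleton
  -- Restricting to fields with a given cyclotomic overfield avoids Kronecker–Weber in bounding the
  -- ramified primes.
  refine Set.Infinite.mono (s := {K | K ∈ _ ∧ ∃ N : ℕ, N ≠ 0 ∧ K ≤ cyclotomicSubfield _ N})
    (fun K hK ↦ hK.1) fun hfin ↦ ?_
  have hex := fun K (hK : K ∈ _) ↦ (hfin.mem_toFinset.mp (hfin.mem_toFinset.mpr hK)).2
  choose! N hN0 hN using hex
  obtain ⟨B, hB⟩ := (hfin.image N).bddAbove
  obtain ⟨q, hqinj, hq⟩ := exists_injective_prime_modEq_one (fun i ↦ (hn i).ne_zero) B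
  choose F hF hFn using fun i ↦
    exists_le_cyclotomicSubfield_finrank_eq (AlgebraicClosure ℚ) (hq i).1 (hq i).2.1
  have h : IsPrimeConductorFamily F q := ⟨fun i ↦ (hq i).1, hqinj, hF⟩
  have := h.numberField_iSup
  have := h.numberField
  have := h.isAbelianGalois
  have hmem : (⨆ i, F i) ∈ {K | K ∈ {K : IntermediateField ℚ (AlgebraicClosure ℚ) |
      ∃ _ : NumberField K,
        IsAbelianGalois ℚ K ∧ Nonempty (Gal(K/ℚ) ≃* G) ∧
        IsTamelyRamified K ∧ IsPolyaField K ∧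
        ∃ (n : ℕ) (F : Fin n → IntermediateField ℚ (AlgebraicClosure ℚ)),
          K = ⨆ i, F i ∧
          ∀ i, ∃ _ : NumberField (F i), IsCyclicPrimePowPolyaField (F i)} ∧
      ∃ N : ℕ, N ≠ 0 ∧ K ≤ cyclotomicSubfield _ N} := by
    refine ⟨⟨inferInstance, h.isAbelianGalois_iSup, ?_, h.isTamelyRamified fun i ↦ ?_,
      h.isPolyaField, Fintype.card ι, fun j ↦ F ((Fintype.equivFin ι).symm j), ?_, fun i ↦ ?_⟩,
      _, (h.prod_ne_zero Finset.univ).ne, h.iSup_le⟩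
    · obtain ⟨g⟩ := h.nonempty_gal_mulEquiv
      refine ⟨(g.trans (MulEquiv.piCongrRight fun i ↦ ?_)).trans f.symm⟩
      have := isCyclic_gal_of_le (hq i).1 (hF i)
      refine mulEquivOfCyclicCardEq ?_
      rw [IsGalois.card_aut_eq_finrank, hFn]
      exact (Nat.card_zmod _).symm
    · rw [hFn]
      have h1 := Nat.le_of_dvd (Nat.sub_pos_of_lt (hq i).1.one_lt) (hq i).2.1
      have h2 := (hq i).1.pos
      omega
    · exact ((Fintype.equivFin ι).symm.iSup_comp (g := F)).symm
    · have := h.numberField ((Fintype.equivFin ι).symm i)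
      exact ⟨this, isCyclicPrimePowPolyaField_of_le (hq _).1 (hF _) (hFn _ ▸ hn _)⟩
  obtain ⟨i⟩ := hι
  have : NeZero (N (⨆ i, F i)) := ⟨hN0 _ hmem⟩
  -- Since `q i > B ≥ N`, the new field would be unramified at `q i`, against its index `n i > 1`.
  have hndvd : ¬ q i ∣ N (⨆ i, F i) := fun hd ↦
    ((hB (Set.mem_image_of_mem N hmem)).trans_lt (hq i).2.2).not_ge
      (Nat.le_of_dvd (Nat.pos_of_neZero _) hd)
  have : (Ideal.span {(q i : ℤ)}).IsPrime := by
    rw [Ideal.span_singleton_prime (by exact_mod_cast (hq i).1.ne_zero)]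
    exact Nat.prime_iff_prime_int.mp (hq i).1
  obtain ⟨P, hP, hPo⟩ := (inferInstance : Nonempty
    (Ideal.primesOver (Ideal.span {(q i : ℤ)}) (𝓞 ↥(⨆ i, F i))))
  have h1 := h.ramificationIdx_eq_finrank i P
  rw [ramificationIdx_eq_one_of_le_cyclotomicSubfield (hN _ hmem) (hq i).1 hndvd P, hFn] at h1
  exact (hn i).one_lt.ne h1
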